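/- Fix an integer parameter $p>0$. The Kadanoff sandpile model KSPM($p$) acts on configurations, i.e. ultimately null sequences $b=(b_i)_{i\in\mathbb N}$ of non-negative integers (slopes). Firing column $i$ takes $b$ to $b'$, written $b\overset{i}{\to}b'$, where $b'_{i-1}=b_{i-1}+p$ (if $i\neq 0$), $b'_i=b_i-(p+1)$, $b'_{i+p}=b_{i+p}+1$, and all other entries are unchanged; it is allowed only if $b'$ is again a configuration, i.e. if $b_i>p$. From every configuration $b$ a unique stable configuration (one in which no column can be fired) is reachable; $\pi(N)$ denotes the stable configuration reachable from $(N,0,0,\dots)$. For $k\ge 1$ the $k$-th avalanche $s^k$ is the lexicographically minimal (leftmost) sequence of columns whose successive firings lead from $\pi(k-1)^{\downarrow 0}$ to $\pi(k)$, where $b^{\downarrow 0}=(b_0+1,b_1,b_2,\dots)$; write $i\in s^k$ if column $i$ is fired in $s^k$. Put $$\mathcal L'(p,k)=\min\{\,l\in\mathbb N \mid \exists m\in\mathbb N:\ (\forall i,\ l\le i\le m\Rightarrow i\in s^k)\text{ and }(\forall i>m,\ i\notin s^k)\,\},$$ $$\mathcal L(p,N)=\max\{\mathcal L'(p,k)\mid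 1\le k\le N\}.$$ Then, for every fixed integer $p>0$, $\mathcal L(p,N)=O(\log N)$ as $N\to\infty$; the implied constant may depend on $p$. -/

import Mathlib

namespace KSPM

/-- Configurations: ultimately null sequences of non-negative integers (slopes). -/
abbrev Config : Type := ℕ →₀ ℕ

/-- `Fires p b i b'` is the transition from `b` to `b'` on column `i` in KSPM(`p`).
The second conjunct says `b' i = b i - (p + 1)` as integers, so it forces `b i > p`. -/
def Fires (p : ℕ) (b : Config) (i : ℕ) (b' : Config) : Prop :=
  (i ≠ 0 → b' (i - 1) = b (i - 1) + p) ∧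
  b' i + (p + 1) = b i ∧
  b' (i + p) = b (i + p) + 1 ∧
  ∀ j : ℕ, j + 1 ≠ i → j ≠ i → j ≠ i + p → b' j = b j

/-- There is a transition from `b` to `b'` on some column. -/
def Step (p : ℕ) (b b' : Config) : Prop := ∃ i : ℕ, Fires p b i b'

/-- `b'` is reachable from `b` by finitely many (possibly zero) transitions. -/
def Reachable (p : ℕ) (b b' : Config) : Prop := Relation.ReflTransGen (Step p) b b'

/-- No transition is possible from `b`. -/
def Stable (p : ℕ) (b : Config) : Prop := ∀ b' : Config, ¬ Step p b b'

/-- `Strategy p b s b'`: firing successively the columns listed in `s` leads from `b` to `b'`. -/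
inductive Strategy (p : ℕ) : Config → List ℕ → Config → Prop
  | nil (b : Config) : Strategy p b [] b
  | cons {b b' b'' : Config} {i : ℕ} {s : List ℕ} :
      Fires p b i b' → Strategy p b' s b'' → Strategy p b (i :: s) b''

/-! Existence and uniqueness of the stable configuration reachable from a configuration. -/

/-- The slopes that a firing of column `i` adds. -/
noncomputable def gain (p i : ℕ) : Config :=
  Finsupp.single (i + p) 1 + if i = 0 then 0 else Finsupp.single (i - 1) p

theorem Fires.pos {p : ℕ} {b b' : Config} {i : ℕ} (h : Fires p b i b') : 0 < p := by
  rcases Nat.eq_zero_or_pos p with rfl | hp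
  · obtain ⟨-, h2, h3, -⟩ := h
    simp only [add_zero] at h3
    omega
  · exact hp

theorem gain_apply (p i j : ℕ) :
    gain p i j = (if i + p = j then 1 else 0) + if i = j + 1 then p else 0 := by
  by_cases hi : i = 0
  · simp [gain, hi, Finsupp.single_apply]
  · have : i - 1 = j ↔ i = j + 1 := by omega
    simp [gain, hi, Finsupp.single_apply, this]

theorem fires_iff {p : ℕ} (hp : 0 < p) {b b' : Config} {i : ℕ} :
    Fires p b i b' ↔ b' + Finsupp.single i (p + 1) = b + gain p i := by
  have e : b' + Finsupp.single i (p + 1) = b + gain p i ↔ ∀ j, b' j + (if i = j then p + 1 else 0)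
      = b j + ((if i + p = j then 1 else 0) + if i = j + 1 then p else 0) := by
    simp only [Finsupp.ext_iff, Finsupp.add_apply, Finsupp.single_apply, gain_apply]
  rw [e, Fires]
  constructor
  · rintro ⟨h1, h2, h3, h4⟩ j
    have := h4 j
    grind
  · intro h
    refine ⟨fun hi => ?_, ?_, ?_, fun j h1 h2 h3 => ?_⟩
    · have := h (i - 1)
      grind
    · have := h i
      grind
    · have := h (i + p)
      grind
    · have := h j
      grind

theorem Fires.unique {p : ℕ} {b c d : Config} {i : ℕ} (h : Fires p b i c) (h' : Fires p b i d) :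
    c = d := by
  have e := (fires_iff h.pos).1 h
  rw [← (fires_iff h.pos).1 h'] at e
  exact add_right_cancel e

theorem exists_fires {p : ℕ} (hp : 0 < p) {b : Config} {i : ℕ} (h : p < b i) :
    ∃ b', Fires p b i b' := by
  refine ⟨b + gain p i - Finsupp.single i (p + 1), (fires_iff hp).2 ?_⟩
  apply tsub_add_cancel_of_le
  intro j
  simp only [Finsupp.single_apply, Finsupp.add_apply]
  split_ifs with hj
  · subst hj; omega
  · exact Nat.zero_le _

theorem Fires.lt {p : ℕ} {b c : Config} {i : ℕ} (h : Fires p b i c) : p < b i := by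
  have := h.2.1; omega

theorem Fires.le {p : ℕ} {b c : Config} {i j : ℕ} (h : Fires p b i c) (hj : j ≠ i) :
    b j ≤ c j := by
  have := congrArg (fun f : Config => f j) ((fires_iff h.pos).1 h)
  simp only [Finsupp.add_apply, Finsupp.single_apply, hj.symm, if_false] at this
  omega

theorem diamond {p : ℕ} {b c d : Config} {i j : ℕ} (hc : Fires p b i c) (hd : Fires p b j d)
    (hij : i ≠ j) : ∃ e, Fires p c j e ∧ Fires p d i e := by
  have hp := hc.pos
  obtain ⟨e, he⟩ := exists_fires hp (lt_of_lt_of_le hc.lt (hd.le hij))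
  refine ⟨e, ?_, he⟩
  rw [fires_iff hp] at *
  apply add_right_cancel (b := Finsupp.single i (p + 1))
  rw [add_right_comm, he, add_right_comm, hd, add_right_comm c, hc, add_right_comm]

/-- The `k`-th moment; used for `k = 1` (conserved) and `k = 2` (increasing). -/
noncomputable def moment (k : ℕ) (b : Config) : ℕ :=
  Finsupp.linearCombination ℕ (fun i : ℕ => (i + 1) ^ k) b

theorem Fires.moment_lt {p : ℕ} {b c : Config} {i : ℕ} (h : Fires p b i c) :
    moment 1 c = moment 1 b ∧ moment 2 b < moment 2 c := by
  have hp := h.pos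
  have e := (fires_iff hp).1 h
  have e1 := congrArg (moment 1) e
  have e2 := congrArg (moment 2) e
  have hadd : ∀ k (x y : Config), moment k (x + y) = moment k x + moment k y :=
    fun k x y => map_add _ x y
  have hsing : ∀ k j n : ℕ, moment k (Finsupp.single j n) = n * (j + 1) ^ k := by
    intro k j n
    simp [moment]
  rcases i with _ | i
  · simp only [gain, if_true, add_zero, hadd, hsing] at e1 e2
    refine ⟨by nlinarith, by nlinarith⟩
  · simp only [gain, Nat.succ_ne_zero, if_false, Nat.add_sub_cancel, hadd, hsing] at e1 e2
    refine ⟨by nlinarith, by nlinarith⟩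

theorem moment_two_le (b : Config) : moment 2 b ≤ moment 1 b ^ 2 := by
  have h1 : ∀ i, b i * (i + 1) ≤ moment 1 b := by
    intro i
    by_cases hi : i ∈ b.support
    · have := Finset.single_le_sum (f := fun i => b i * (i + 1)) (fun _ _ => Nat.zero_le _) hi
      simpa [moment, Finsupp.linearCombination_apply, Finsupp.sum] using this
    · simp at hi; simp [hi]
  have h2 : moment 2 b ≤ ∑ i ∈ b.support, moment 1 b * (b i * (i + 1)) := by
    simp only [moment, Finsupp.linearCombination_apply, Finsupp.sum, smul_eq_mul]
    apply Finset.sum_le_sum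
    intro i hi
    have h3 := h1 i
    have h4 : 1 ≤ b i := Nat.one_le_iff_ne_zero.2 (by simpa using hi)
    have h5 : i + 1 ≤ moment 1 b := le_trans (by nlinarith) h3
    simp only [moment, Finsupp.linearCombination_apply, Finsupp.sum, smul_eq_mul] at h5
    calc b i * (i + 1) ^ 2 = (i + 1) * (b i * (i + 1)) := by ring
      _ ≤ _ := Nat.mul_le_mul_right _ h5
  refine h2.trans (le_of_eq ?_)
  rw [← Finset.mul_sum, sq]
  congr 1
  simp [moment, Finsupp.linearCombination_apply, Finsupp.sum]

theorem Strategy.reachable {p : ℕ} {b c : Config} {s : List ℕ} (h : Strategy p b s c) :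
    Reachable p b c := by
  induction h with
  | nil b => exact Relation.ReflTransGen.refl
  | cons h _ ih => exact Relation.ReflTransGen.head ⟨_, h⟩ ih

theorem Strategy.eq_nil {p : ℕ} {b c : Config} {s : List ℕ} (h : Strategy p b s c)
    (hb : Stable p b) : s = [] := by
  cases h with
  | nil => rfl
  | cons h _ => exact absurd ⟨_, h⟩ (hb _)

/-- From every configuration, firing the leftmost possible column as long as possible yields a
stable configuration, and the strategy obtained is lexicographically minimal. -/
theorem exists_leftmost (p : ℕ) (b : Config) :
    ∃ c, Stable p c ∧ ∃ s, IsLeast {s : List ℕ | Strategy p b s c} s := by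
  classical
  induction hn : moment 1 b ^ 2 - moment 2 b using Nat.strong_induction_on generalizing b with
  | _ n ih =>
    by_cases hb : Stable p b
    · exact ⟨b, hb, [], .nil b, fun t ht => by rw [ht.eq_nil hb]⟩
    · have hex : ∃ i c, Fires p b i c := by
        simp only [Stable, not_forall, not_not] at hb
        obtain ⟨c, i, h⟩ := hb
        exact ⟨i, c, h⟩
      obtain ⟨d, hd⟩ := Nat.find_spec hex
      have hm := hd.moment_lt
      have := moment_two_le d
      rw [hm.1] at this
      obtain ⟨c, hc, s, hs, hmin⟩ := ih (moment 1 d ^ 2 - moment 2 d)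
        (by rw [hm.1]; omega) d rfl
      refine ⟨c, hc, Nat.find hex :: s, .cons hd hs, ?_⟩
      intro t ht
      cases ht with
      | nil => exact absurd hc hb
      | @cons _ d' _ j t' hj ht' =>
        rcases (Nat.find_min' hex ⟨_, hj⟩).lt_or_eq with hlt | heq
        · exact le_of_lt (List.Lex.rel hlt)
        · rw [heq] at hd ⊢
          rw [hj.unique hd] at ht'
          exact List.cons_le_cons _ (hmin ht')

theorem exists_stable (p : ℕ) (b : Config) : ∃ c, Reachable p b c ∧ Stable p c := by
  obtain ⟨c, hc, s, hs, -⟩ := exists_leftmost p b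
  exact ⟨c, Strategy.reachable hs, hc⟩

theorem Stable.eq_of_reachable {p : ℕ} {b c : Config} (hb : Stable p b) (h : Reachable p b c) :
    b = c := by
  rcases Relation.ReflTransGen.cases_head h with h | ⟨d, hd, -⟩
  · exact h
  · exact absurd hd (hb d)

theorem stable_unique {p : ℕ} {b c d : Config} (hc : Reachable p b c) (hc' : Stable p c)
    (hd : Reachable p b d) (hd' : Stable p d) : c = d := by
  obtain ⟨e, h1, h2⟩ := Relation.church_rosser (r := Step p) (fun b c d hc hd => by
    obtain ⟨i, hi⟩ := hc
    obtain ⟨j, hj⟩ := hd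
    by_cases hij : i = j
    · subst hij
      rw [hi.unique hj]
      exact ⟨d, .refl, .refl⟩
    · obtain ⟨e, h1, h2⟩ := diamond hi hj hij
      exact ⟨e, .single ⟨_, h1⟩, .single ⟨_, h2⟩⟩) hc hd
  rw [hc'.eq_of_reachable h1, hd'.eq_of_reachable h2]

/-- The unique stable configuration reachable from `b`. -/
noncomputable def fixedPoint (p : ℕ) (b : Config) : Config := (exists_stable p b).choose

theorem fixedPoint_spec (p : ℕ) (b : Config) :
    Reachable p b (fixedPoint p b) ∧ Stable p (fixedPoint p b) := (exists_stable p b).choose_spec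

theorem fixedPoint_eq {p : ℕ} {b c : Config} (h : Reachable p b c) (hc : Stable p c) :
    fixedPoint p b = c :=
  stable_unique (fixedPoint_spec p b).1 (fixedPoint_spec p b).2 h hc

/-- The initial configuration `(N, 0, 0, …)`: `N` grains stacked on column `0`. -/
noncomputable def initial (N : ℕ) : Config := Finsupp.single 0 N

/-- The fixed point `π(N)` of the initial configuration with `N` grains. -/
noncomputable def piFixed (p N : ℕ) : Config := fixedPoint p (initial N)

/-- The configuration obtained from `b` by adding one grain on column `0`. -/
noncomputable def addGrain (b : Config) : Config := b + Finsupp.single 0 1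

theorem reachable_addGrain {p : ℕ} {b c : Config} (h : Reachable p b c) :
    Reachable p (addGrain b) (addGrain c) := by
  refine Relation.ReflTransGen.lift (r := Step p) addGrain (fun b c => ?_) _ _ h
  rintro ⟨i, hi⟩
  refine ⟨i, (fires_iff hi.pos).2 ?_⟩
  rw [addGrain, addGrain, add_right_comm, (fires_iff hi.pos).1 hi, add_right_comm]

/-- Adding a grain to `π(n)` and stabilizing gives `π(n + 1)`. -/
theorem fixedPoint_addGrain (p n : ℕ) :
    fixedPoint p (addGrain (piFixed p n)) = piFixed p (n + 1) := by
  symm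
  refine fixedPoint_eq ?_ (fixedPoint_spec _ _).2
  have h := reachable_addGrain (fixedPoint_spec p (initial n)).1
  have e : addGrain (initial n) = initial (n + 1) := by
    simp [addGrain, initial, ← Finsupp.single_add]
  rw [e] at h
  exact Relation.ReflTransGen.trans h (fixedPoint_spec p _).1

theorem exists_avalanche (p n : ℕ) :
    ∃ s, IsLeast {s : List ℕ | Strategy p (addGrain (piFixed p n)) s (piFixed p (n + 1))} s := by
  obtain ⟨c, hc, s, hs⟩ := exists_leftmost p (addGrain (piFixed p n))
  rw [← fixedPoint_addGrain, fixedPoint_eq (Strategy.reachable hs.1) hc]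
  exact ⟨s, hs⟩

/-- `avalanche p n` is the avalanche that leads from `π(n)` with one grain added on column `0` to
`π(n + 1)`, that is, the avalanche of number `n + 1` (avalanches are numbered from `1`): among all
strategies between these two configurations it is the minimal (leftmost) one for the
lexicographic order on lists. -/
noncomputable def avalanche (p n : ℕ) : List ℕ := (exists_avalanche p n).choose

theorem avalanche_spec (p n : ℕ) :
    IsLeast {s : List ℕ | Strategy p (addGrain (piFixed p n)) s (piFixed p (n + 1))}
      (avalanche p n) := (exists_avalanche p n).choose_spec

/-- The fired columns of the list `s` that are at least `l` form a block `l, …, m` without holes. -/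
def DenseFrom (s : List ℕ) (l : ℕ) : Prop :=
  ∃ m : ℕ, (∀ i : ℕ, l ≤ i → i ≤ m → i ∈ s) ∧ ∀ i : ℕ, m < i → i ∉ s

/-- The set over which the minimum in `localDensityColumn` is taken is not empty. -/
theorem exists_denseFrom (s : List ℕ) : ∃ l : ℕ, DenseFrom s l := by
  refine ⟨s.sum + 1, s.sum, fun i h1 h2 => by omega, fun i hi hs => ?_⟩
  have := List.le_sum_of_mem hs
  omega

/-- The minimal column starting from which the avalanche of number `n + 1` is dense. -/
noncomputable def localDensityColumn (p n : ℕ) : ℕ := sInf {l : ℕ | DenseFrom (avalanche p n) l}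

/-- The global density column: the maximum of the minimal density columns of the first `N`
avalanches. -/
noncomputable def globalDensityColumn (p N : ℕ) : ℕ :=
  (Finset.range N).sup fun n => localDensityColumn p n

end KSPM

namespace KSPM

open Finset

/-! Let `a i` be the number of firings of column `i` on the way to `π(n)`, and `d i = a i - a (i +
1)`. The balance of slopes says that `d (i + p)` is the mean of the `p` previous values of `d`,
minus `1 / p` times the slope at `i + p`, which lies in `[0, p]`. Averaging contracts: as long as no
`p` consecutive values agree, their spread shrinks by the factor `1 - 1 / p ^ p` every `p` columns
(`Averaging.contraction`). The spread is initially at most `2 * n ^ 2` and `d` is integral, so a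
constant window occurs within `O(log n)` columns (`Averaging.exists_constWindow`).

From then on integrality is rigid: every slope `p` begins a run `p, p - 1, …, 1` (`Averaging.wave`).
A hole in the next avalanche would need a zero slope fewer than `p` columns after a slope `p`, which
such runs exclude (`mem_avalanche_of_succ_mem`). -/

/-! ### Firing counts of strategies -/

/-- Balance of the slope of column `j` along a strategy. -/
theorem Strategy.balance {p : ℕ} {b c : Config} {s : List ℕ} (h : Strategy p b s c) (j : ℕ) :
    c j + (p + 1) * s.count j =
      b j + (if p ≤ j then s.count (j - p) else 0) + p * s.count (j + 1) := by
  induction h with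
  | nil b => simp
  | @cons b b' b'' i s hi _ ih =>
    have e := congrArg (fun f : Config => f j) ((fires_iff hi.pos).1 hi)
    simp only [Finsupp.add_apply, Finsupp.single_apply, gain_apply] at e
    simp only [List.count_cons, beq_iff_eq]
    have h1 : (if p ≤ j then s.count (j - p) + (if i = j - p then 1 else 0) else 0)
        = (if p ≤ j then s.count (j - p) else 0) + if i + p = j then 1 else 0 := by
      split_ifs <;> omega
    have h2 : (p + 1) * (if i = j then 1 else 0) = if i = j then p + 1 else 0 := by
      split_ifs <;> simp
    have h3 : p * (if i = j + 1 then 1 else 0) = if i = j + 1 then p else 0 := by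
      split_ifs <;> simp
    rw [h1, mul_add, mul_add, h2, h3]
    omega

/-- Each firing preserves the first moment and increases the second, which never exceeds the square
of the first. -/
theorem Strategy.length_le {p : ℕ} {b c : Config} {s : List ℕ} (h : Strategy p b s c) :
    s.length ≤ moment 1 b ^ 2 := by
  have key : moment 1 c = moment 1 b ∧ s.length + moment 2 b ≤ moment 2 c := by
    induction h with
    | nil b => simp
    | cons hi _ ih =>
      obtain ⟨h1, h2⟩ := hi.moment_lt
      refine ⟨ih.1.trans h1, ?_⟩
      rw [List.length_cons]
      omega
  have := moment_two_le c
  rw [key.1] at this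
  omega

theorem Reachable.exists_strategy {p : ℕ} {b c : Config} (h : Reachable p b c) :
    ∃ s, Strategy p b s c := by
  induction h using Relation.ReflTransGen.head_induction_on with
  | refl => exact ⟨[], .nil _⟩
  | head h _ ih =>
    obtain ⟨i, hi⟩ := h
    obtain ⟨s, hs⟩ := ih
    exact ⟨i :: s, .cons hi hs⟩

theorem Stable.le {p : ℕ} (hp : 0 < p) {b : Config} (h : Stable p b) (i : ℕ) : b i ≤ p := by
  by_contra! hi
  obtain ⟨b', hb'⟩ := exists_fires hp hi
  exact h b' ⟨i, hb'⟩

/-- Least action principle: a strategy fires no column more often than a vector `u` whose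
(possibly illegal) firing stabilizes the configuration. -/
theorem Strategy.count_le {p : ℕ} {b c : Config} {s : List ℕ} (h : Strategy p b s c) (u : ℕ → ℕ)
    (hu : ∀ j, b j + (if p ≤ j then u (j - p) else 0) + p * u (j + 1) ≤ p + (p + 1) * u j)
    (j : ℕ) : s.count j ≤ u j := by
  induction h generalizing u with
  | nil b => simp
  | @cons b b' b'' i s hi _ ih =>
    -- If `u i = 0`, then `hu i` gives `b i ≤ p` and column `i` could not fire. So one firing of `i`
    -- can be taken off `u`.
    have hpos : 1 ≤ u i := by
      have h1 := hu i
      have h2 := hi.lt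
      by_contra! h0
      have h0 : u i = 0 := by omega
      rw [h0] at h1
      omega
    have hdec : ∀ k, u k = (u k - if i = k then 1 else 0) + if i = k then 1 else 0 := by
      intro k
      split_ifs with hk
      · subst hk; omega
      · rfl
    have := ih (fun k => u k - if i = k then 1 else 0) (fun k => by
      have e := congrArg (fun f : Config => f k) ((fires_iff hi.pos).1 hi)
      simp only [Finsupp.add_apply, Finsupp.single_apply, gain_apply] at e
      have h0 := hu k
      have h1 : (if p ≤ k then u (k - p) else 0)
          = (if p ≤ k then u (k - p) - (if i = k - p then 1 else 0) else 0)
            + if i + p = k then 1 else 0 := by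
        have := hdec (k - p)
        split_ifs at this ⊢ <;> omega
      have h2 : (p + 1) * u k
          = (p + 1) * (u k - if i = k then 1 else 0) + if i = k then p + 1 else 0 := by
        conv_lhs => rw [hdec k, mul_add]
        split_ifs <;> simp
      have h3 : p * u (k + 1)
          = p * (u (k + 1) - if i = k + 1 then 1 else 0) + if i = k + 1 then p else 0 := by
        conv_lhs => rw [hdec (k + 1), mul_add]
        split_ifs <;> simp
      rw [h1, h2, h3] at h0
      omega)
    have h1 := hdec j
    simp only [List.count_cons, beq_iff_eq]
    omega

/-! Sequences in which each term is the average of the `p` previous ones, up to a defect in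
`[0, 1]`. -/

/-- The `p` terms of `d` from the index `i` on are equal. -/
def ConstWindow (p : ℕ) (d : ℕ → ℤ) (i : ℕ) : Prop := ∃ c, ∀ k < p, d (i + k) = c

/-- `d` satisfies the averaging recurrence of order `p` with defects `b j / p ∈ [0, 1]`. -/
structure Averaging (p : ℕ) (d b : ℕ → ℤ) : Prop where
  eq : ∀ i, b (i + p) = ∑ k ∈ range p, d (i + k) - p * d (i + p)
  nonneg : ∀ i, 0 ≤ b i
  le : ∀ i, b i ≤ p

variable {p : ℕ} {d b : ℕ → ℤ}

/-- In a non-constant window the sum exceeds `p * m`, so a next value `≤ m - 1` would have defect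
greater than `p`. -/
theorem Averaging.lower (h : Averaging p d b) (hp : 0 < p) {i : ℕ} {m : ℤ}
    (hm : ∀ k < p, m ≤ d (i + k)) (hc : ¬ ConstWindow p d i) : m ≤ d (i + p) := by
  have h1 : ∑ _k ∈ range p, m < ∑ k ∈ range p, d (i + k) := by
    apply sum_lt_sum (fun k hk => hm k (mem_range.1 hk))
    by_contra! hle
    exact hc ⟨m, fun k hk => le_antisymm (hle k (mem_range.2 hk)) (hm k hk)⟩
  rw [sum_const, card_range, nsmul_eq_mul] at h1
  have h2 := h.eq i
  have h3 := h.le (i + p)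
  have hp' : (0 : ℤ) < p := by exact_mod_cast hp
  by_contra! hlt
  nlinarith

/-- A non-negative defect keeps the next value below the mean, and a single term `δ` below `M`
lowers the bound on the mean by `δ / p`. -/
theorem Averaging.upper (h : Averaging p d b) (hp : 0 < p) {i k₀ : ℕ} (hk₀ : k₀ < p) {M δ : ℝ}
    (hM : ∀ k < p, (d (i + k) : ℝ) ≤ M) (hδ : (d (i + k₀) : ℝ) ≤ M - δ) :
    (d (i + p) : ℝ) ≤ M - δ / p := by
  have h1 : ∑ k ∈ range p, (d (i + k) : ℝ) ≤ ∑ k ∈ range p, (M - if k = k₀ then δ else 0) := by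
    apply sum_le_sum
    intro k hk
    split_ifs with hkk
    · rw [hkk]; exact hδ
    · simpa using hM k (mem_range.1 hk)
  rw [sum_sub_distrib, sum_const, card_range, nsmul_eq_mul, sum_ite_eq' (range p) k₀,
    if_pos (mem_range.2 hk₀)] at h1
  have h2 : (p : ℝ) * d (i + p) ≤ ∑ k ∈ range p, (d (i + k) : ℝ) := by
    have h3 := h.nonneg (i + p)
    rw [h.eq i] at h3
    have h4 : (p : ℤ) * d (i + p) ≤ ∑ k ∈ range p, d (i + k) := by linarith
    exact_mod_cast h4
  have hp' : (0 : ℝ) < p := by exact_mod_cast hp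
  have h5 : (p : ℝ) * d (i + p) ≤ p * (M - δ / p) := by
    rw [mul_sub, mul_div_cancel₀ _ hp'.ne']
    linarith
  exact le_of_mul_le_mul_left h5 hp'

/-- Over `p` successive steps without constant window, the lower bound of the window is kept and
its upper bound decreases by a fixed fraction of the amplitude. -/
theorem Averaging.contraction (h : Averaging p d b) (hp : 0 < p) {i k₀ : ℕ} (hk₀ : k₀ < p) {M : ℝ}
    (hm : ∀ k < p, d (i + k₀) ≤ d (i + k)) (hM : ∀ k < p, (d (i + k) : ℝ) ≤ M)
    (hc : ∀ k < p, ¬ ConstWindow p d (i + k)) :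
    ∀ k < p, d (i + k₀) ≤ d (i + p + k) ∧
      (d (i + p + k) : ℝ) ≤ M - (M - d (i + k₀)) / (p : ℝ) ^ p := by
  have hp1 : (1 : ℝ) ≤ p := by exact_mod_cast hp
  have hD : 0 ≤ M - d (i + k₀) := sub_nonneg.2 (hM k₀ hk₀)
  have key : ∀ k < p, d (i + k₀) ≤ d (i + p + k) ∧
      (d (i + p + k) : ℝ) ≤ M - (M - d (i + k₀)) / (p : ℝ) ^ (k + 1) := by
    intro k
    induction k using Nat.strong_induction_on with
    | _ k ih =>
      intro hk
      have hwin : ∀ j < p, d (i + k₀) ≤ d (i + k + j) ∧ (d (i + k + j) : ℝ) ≤ M := by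
        intro j hj
        by_cases hkj : k + j < p
        · rw [add_assoc]
          exact ⟨hm _ hkj, hM _ hkj⟩
        · have e : i + k + j = i + p + (k + j - p) := by omega
          obtain ⟨h1, h2⟩ := ih (k + j - p) (by omega) (by omega)
          rw [e]
          refine ⟨h1, h2.trans ?_⟩
          have : 0 ≤ (M - d (i + k₀)) / (p : ℝ) ^ (k + j - p + 1) := by positivity
          linarith
      have e : i + p + k = i + k + p := by omega
      rw [e]
      refine ⟨h.lower hp (fun j hj => (hwin j hj).1) (hc k hk), ?_⟩
      rw [pow_succ, ← div_div]
      -- The first new term gains from the minimum at `k₀`; each later one gains from its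
      -- predecessor, losing one more factor `p`.
      rcases Nat.eq_zero_or_pos k with rfl | hk0
      · apply h.upper hp hk₀ (fun j hj => (hwin j hj).2)
        simp
      · apply h.upper hp (k₀ := p - 1) (by omega) (fun j hj => (hwin j hj).2)
        have e' : i + k + (p - 1) = i + p + (k - 1) := by omega
        obtain ⟨-, h2⟩ := ih (k - 1) (by omega) (by omega)
        rw [Nat.sub_add_cancel hk0] at h2
        rw [e']
        exact h2
  intro k hk
  refine ⟨(key k hk).1, (key k hk).2.trans ?_⟩
  gcongr
  exact hk

theorem Averaging.exists_constWindow (h : Averaging p d b) (hp : 0 < p) {A : ℝ} {t : ℕ}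
    (hA : ∀ i j, (d i : ℝ) - d j ≤ A) (ht : A * (1 - 1 / (p : ℝ) ^ p) ^ t < 1) :
    ∃ i ≤ p * t, ConstWindow p d i := by
  by_contra! hc
  have hmin : ∀ i, ∃ k₀ < p, ∀ k < p, d (i + k₀) ≤ d (i + k) := by
    intro i
    obtain ⟨k₀, h1, h2⟩ := exists_min_image (range p) (fun k => d (i + k)) ⟨0, mem_range.2 hp⟩
    exact ⟨k₀, mem_range.1 h1, fun k hk => h2 k (mem_range.2 hk)⟩
  have hp1 : (1 : ℝ) ≤ p := by exact_mod_cast hp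
  have hq : 0 ≤ 1 - 1 / (p : ℝ) ^ p := by
    have : 1 / (p : ℝ) ^ p ≤ 1 := by
      rw [div_le_one (by positivity)]
      exact one_le_pow₀ hp1
    linarith
  have key : ∀ n ≤ t, ∃ k₀ < p, ∃ M : ℝ, (∀ k < p, d (p * n + k₀) ≤ d (p * n + k)) ∧
      (∀ k < p, (d (p * n + k) : ℝ) ≤ M) ∧
      M - d (p * n + k₀) ≤ A * (1 - 1 / (p : ℝ) ^ p) ^ n := by
    intro n
    induction n with
    | zero =>
      intro _
      obtain ⟨k₀, h1, h2⟩ := hmin (p * 0)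
      refine ⟨k₀, h1, A + d (p * 0 + k₀), h2, fun k _ => ?_, by simp⟩
      have := hA (p * 0 + k) (p * 0 + k₀)
      linarith
    | succ n ih =>
      intro hn
      obtain ⟨k₀, hk₀, M, hm, hM, hle⟩ := ih (by omega)
      have hcon := h.contraction hp hk₀ hm hM (fun k hk => hc _ (by
        have := Nat.mul_le_mul_left p hn
        rw [Nat.mul_succ] at this
        omega))
      rw [mul_add, mul_one]
      obtain ⟨k₁, hk₁, hm₁⟩ := hmin (p * n + p)
      refine ⟨k₁, hk₁, _, hm₁, fun k hk => (hcon k hk).2, ?_⟩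
      have h1 : (d (p * n + k₀) : ℝ) ≤ d (p * n + p + k₁) := by exact_mod_cast (hcon k₁ hk₁).1
      calc M - (M - d (p * n + k₀)) / (p : ℝ) ^ p - d (p * n + p + k₁)
          ≤ M - (M - d (p * n + k₀)) / (p : ℝ) ^ p - d (p * n + k₀) := by linarith
        _ = (M - d (p * n + k₀)) * (1 - 1 / (p : ℝ) ^ p) := by ring
        _ ≤ A * (1 - 1 / (p : ℝ) ^ p) ^ n * (1 - 1 / (p : ℝ) ^ p) :=
          mul_le_mul_of_nonneg_right hle hq
        _ = _ := by ring
  obtain ⟨k₀, -, M, hm, hM, hle⟩ := key t le_rfl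
  -- An integral window of spread less than `1` is constant.
  refine hc _ le_rfl ⟨d (p * t + k₀), fun k hk => le_antisymm ?_ (hm k hk)⟩
  have h1 : (d (p * t + k) : ℝ) < d (p * t + k₀) + 1 := by linarith [hM k hk]
  have h2 : d (p * t + k) < d (p * t + k₀) + 1 := by exact_mod_cast h1
  omega

/-! ### Rigidity after a constant window -/

/-- The window from `i` on is `c, …, c, c - 1, …, c - 1` with `k` terms `c - 1`. -/
def StepWindow (p : ℕ) (d : ℕ → ℤ) (i k : ℕ) (c : ℤ) : Prop :=
  ∀ t < p, d (i + t) = if t + k < p then c else c - 1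

theorem StepWindow.sum {i k : ℕ} {c : ℤ} (hw : StepWindow p d i k c) (hk : k ≤ p) :
    ∑ t ∈ range p, d (i + t) = p * c - k := by
  have h1 : ∑ t ∈ range p, d (i + t) = ∑ t ∈ range p, (c - if p - k ≤ t then 1 else 0) := by
    apply sum_congr rfl
    intro t ht
    rw [hw t (mem_range.1 ht)]
    split_ifs <;> omega
  have h2 : (range p).filter (fun t => p - k ≤ t) = Ico (p - k) p := by
    ext t
    simp only [mem_filter, mem_range, mem_Ico]
    omega
  rw [h1, sum_sub_distrib, sum_const, card_range, nsmul_eq_mul, sum_boole, h2, Nat.card_Ico,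
    Nat.sub_sub_self hk]

theorem StepWindow.succ {i k : ℕ} {c : ℤ} (hw : StepWindow p d i k c)
    (hd : d (i + p) = c - 1) : StepWindow p d (i + 1) (k + 1) c := by
  intro t ht
  rw [add_assoc, add_comm 1 t]
  by_cases h1 : t + 1 < p
  · rw [hw _ h1]
    congr 1
    apply propext
    omega
  · have : t + 1 = p := by omega
    rw [this, hd, if_neg (by omega)]

/-- The defect is `p * (c - d (i + p)) - k`; for `0 < k < p` only one integer value of `d (i + p)`
puts it in `[0, p]`. -/
theorem Averaging.step (h : Averaging p d b) {i k : ℕ} {c : ℤ} (hw : StepWindow p d i k c)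
    (hk0 : 0 < k) (hk : k < p) : b (i + p) = p - k ∧ d (i + p) = c - 1 := by
  have h1 := h.eq i
  rw [hw.sum hk.le] at h1
  have h2 := h.nonneg (i + p)
  have h3 := h.le (i + p)
  have hd : d (i + p) = c - 1 := by
    have h4 : d (i + p) < c := by
      by_contra! h4
      nlinarith
    have h5 : c - 2 < d (i + p) := by
      by_contra! h5
      nlinarith
    omega
  refine ⟨?_, hd⟩
  rw [h1, hd]
  ring

theorem Averaging.exists_stepWindow (h : Averaging p d b) (hp : 0 < p) {i : ℕ}
    (hi : ConstWindow p d i) {j : ℕ} (hij : i ≤ j) : ∃ k < p, ∃ c, StepWindow p d j k c := by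
  induction j, hij using Nat.le_induction with
  | base =>
    obtain ⟨c, hc⟩ := hi
    exact ⟨0, hp, c, fun t ht => by rw [hc t ht, if_pos (by omega)]⟩
  | succ j _ ih =>
    obtain ⟨k, hk, c, hw⟩ := ih
    have next : d (j + p) = c - 1 → ∃ k < p, ∃ c, StepWindow p d (j + 1) k c := by
      intro hd
      have hw' := hw.succ hd
      by_cases hkp : k + 1 < p
      · exact ⟨k + 1, hkp, c, hw'⟩
      · refine ⟨0, hp, c - 1, fun t ht => ?_⟩
        rw [hw' t ht, if_neg (by omega), if_pos (by omega)]
    -- Only a constant window leaves a choice: the next value is `c` (defect `0`) or `c - 1` (defect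
    -- `p`).
    rcases Nat.eq_zero_or_pos k with rfl | hk0
    · have h1 := h.eq j
      rw [hw.sum (Nat.zero_le p)] at h1
      have h2 := h.nonneg (j + p)
      have h3 := h.le (j + p)
      have hp' : (0 : ℤ) < p := by exact_mod_cast hp
      have h4 : d (j + p) ≤ c := by
        by_contra! h4
        push_cast at h1
        nlinarith
      have h5 : c - 1 ≤ d (j + p) := by
        by_contra! h5
        push_cast at h1
        nlinarith
      rcases h4.lt_or_eq with h4 | h4
      · exact next (by omega)
      · refine ⟨0, hp, c, fun t ht => ?_⟩
        rw [add_zero, if_pos ht, add_assoc, add_comm 1 t]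
        by_cases ht1 : t + 1 < p
        · rw [hw _ ht1, if_pos (by omega)]
        · rw [show t + 1 = p by omega, h4]
    · exact next (h.step hw hk0 hk).2

/-- After a constant window, each defect `p` starts a wave `p, p - 1, …, 1`. -/
theorem Averaging.wave (h : Averaging p d b) (hp : 0 < p) {i : ℕ} (hi : ConstWindow p d i)
    {x : ℕ} (hx : i + p ≤ x) (hb : b x = p) {k : ℕ} (hk : k < p) : b (x + k) = p - k := by
  obtain ⟨j, rfl⟩ : ∃ j, x = j + p := ⟨x - p, by omega⟩
  obtain ⟨k', hk', c, hw⟩ := h.exists_stepWindow hp hi (j := j) (by omega)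
  -- With `0 < k'` the defect would be `p - k' < p`.
  have hk0 : k' = 0 := by
    by_contra hne
    have := (h.step hw (Nat.pos_of_ne_zero hne) hk').1
    omega
  subst hk0
  have hd : d (j + p) = c - 1 := by
    have h1 := h.eq j
    rw [hw.sum (Nat.zero_le p), hb] at h1
    have hp' : (p : ℤ) ≠ 0 := by exact_mod_cast hp.ne'
    apply mul_left_cancel₀ hp'
    push_cast at h1
    linarith
  have key : ∀ k < p, StepWindow p d (j + (k + 1)) (k + 1) c := by
    intro k
    induction k with
    | zero => exact fun _ => hw.succ hd
    | succ k ih =>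
      intro hk
      have hw' := ih (by omega)
      exact hw'.succ (h.step hw' (Nat.succ_pos k) hk).2
  rcases k with _ | k
  · simpa using hb
  · have := (h.step (key k (by omega)) (Nat.succ_pos k) hk).1
    rwa [show j + p + (k + 1) = j + (k + 1) + p by omega]

/-! Application to fixed points and avalanches. -/

theorem piFixed_le (hp : 0 < p) (n i : ℕ) : piFixed p n i ≤ p :=
  (fixedPoint_spec p (initial n)).2.le hp i

/-- `d` is the difference of consecutive firing counts; its window sums telescope, which turns the
balance into the recurrence. -/
theorem exists_averaging_piFixed (hp : 0 < p) (n : ℕ) :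
    ∃ d : ℕ → ℤ, Averaging p d (fun i => piFixed p n i) ∧
      ∀ i j, (d i : ℝ) - d j ≤ 2 * (n : ℝ) ^ 2 := by
  obtain ⟨s, hs⟩ := Reachable.exists_strategy (fixedPoint_spec p (initial n)).1
  have hlen : s.length ≤ n ^ 2 := by
    simpa [initial, moment] using hs.length_le
  refine ⟨fun i => (s.count i : ℤ) - s.count (i + 1), ⟨fun i => ?_, fun i => by positivity,
    fun i => by exact_mod_cast piFixed_le hp n i⟩, fun i j => ?_⟩
  · have h1 := hs.balance (i + p)
    rw [if_pos (Nat.le_add_left p i), Nat.add_sub_cancel] at h1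
    have h2 : initial n (i + p) = 0 := by
      simp only [initial, Finsupp.single_apply]
      rw [if_neg (by omega)]
    have h3 := sum_range_sub' (fun k => (s.count (i + k) : ℤ)) p
    have h4 : ∑ k ∈ range p, ((s.count (i + k) : ℤ) - s.count (i + k + 1))
        = s.count i - s.count (i + p) := h3
    rw [h4]
    rw [h2] at h1
    change ((fixedPoint p (initial n) (i + p) : ℕ) : ℤ) = _
    zify at h1
    linarith
  · have h1 : ∀ k, (s.count k : ℝ) ≤ (n : ℝ) ^ 2 := fun k => by
      exact_mod_cast (List.count_le_length.trans hlen)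
    have h2 : ∀ k, (0 : ℝ) ≤ s.count k := fun k => by positivity
    push_cast
    linarith [h1 i, h1 (j + 1), h2 (i + 1), h2 j]

/-! ### Holes in an avalanche -/

/-- By least action: firing every column once already stabilizes `π(n)` with one grain added. -/
theorem avalanche_count_le_one (hp : 0 < p) (n j : ℕ) : (avalanche p n).count j ≤ 1 := by
  refine (avalanche_spec p n).1.count_le (fun _ => 1) (fun j => ?_) j
  have := piFixed_le hp n j
  simp only [addGrain, Finsupp.add_apply, Finsupp.single_apply]
  split_ifs <;> omega

/-- If, from column `l` on, each slope `p` of `π(n)` is followed by `p - 1` non-zero slopes, then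
the next avalanche has no hole from column `l + p` on. -/
theorem mem_avalanche_of_succ_mem (hp : 0 < p) {n l : ℕ}
    (hl : ∀ x, l ≤ x → piFixed p n x = p → ∀ k < p, piFixed p n (x + k) ≠ 0) {i : ℕ}
    (hi : l + p ≤ i) (hmem : i + 1 ∈ avalanche p n) : i ∈ avalanche p n := by
  by_contra hnot
  have hs := (avalanche_spec p n).1
  set s := avalanche p n with hsdef
  have hone : ∀ j, s.count j ≤ 1 := avalanche_count_le_one hp n
  have hbal : ∀ j, 0 < j → p ≤ j → piFixed p (n + 1) j + (p + 1) * s.count j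
      = piFixed p n j + s.count (j - p) + p * s.count (j + 1) := by
    intro j hj hpj
    have h1 := hs.balance j
    have h2 : addGrain (piFixed p n) j = piFixed p n j := by
      simp only [addGrain, Finsupp.add_apply, Finsupp.single_apply]
      rw [if_neg (by omega), add_zero]
    rwa [if_pos hpj, h2] at h1
  have h0 : s.count i = 0 := List.count_eq_zero.2 hnot
  have h1 : s.count (i + 1) = 1 := le_antisymm (hone _) (List.count_pos_iff.2 hmem)
  -- The unfired column `i` receives `p` from `i + 1` and still ends with slope at most `p`.
  have hbi : piFixed p n i = 0 := by
    have := hbal i (by omega) (by omega)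
    rw [h0, h1] at this
    have := piFixed_le hp (n + 1) i
    omega
  -- Otherwise the firings in columns `≤ i` alone would stabilize, and least action would forbid
  -- firing `i + 1`.
  obtain ⟨j, hj1, hj2, hbj, hsj⟩ : ∃ j, i < j ∧ j ≤ i + p ∧ piFixed p n j = p ∧
      s.count (j - p) = 1 := by
    by_contra! hno
    have := hs.count_le (fun k => if k ≤ i then s.count k else 0) (fun k => ?_) (i + 1)
    · simp [h1] at this
    · have hle := piFixed_le hp n k
      have hz : 0 < k → addGrain (piFixed p n) k = piFixed p n k := fun hk => by
        simp only [addGrain, Finsupp.add_apply, Finsupp.single_apply]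
        rw [if_neg (by omega), add_zero]
      by_cases hk : k ≤ i
      · have hb := hs.balance k
        have hle' := piFixed_le hp (n + 1) k
        have hcut : (if k + 1 ≤ i then s.count (k + 1) else 0) ≤ s.count (k + 1) := by
          split_ifs <;> simp
        have hcut' := Nat.mul_le_mul_left p hcut
        rw [if_pos hk, if_pos (show k - p ≤ i by omega)]
        omega
      · rw [if_neg hk, if_neg (show ¬ k + 1 ≤ i by omega), hz (by omega), if_pos (by omega)]
        have h2 := hone (k - p)
        have h3 := hno k (by omega)
        split_ifs with h4
        · have h5 := h3 (by omega)
          omega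
        · omega
  have hjp : j - p < i := by
    rcases (show j - p ≤ i by omega).lt_or_eq with h | h
    · exact h
    · rw [h, h0] at hsj
      omega
  -- Column `j - p` fires and `i` does not, so some fired `x` between them has `x + 1` unfired. Such
  -- an `x` gets at most one unit, from `x - p`, hence had slope `p`.
  obtain ⟨x, hx1, hx2, hx3, hx4⟩ : ∃ x, j - p ≤ x ∧ x < i ∧ s.count x = 1 ∧
      s.count (x + 1) = 0 := by
    by_contra! hno
    have : ∀ y, j - p ≤ y → y ≤ i → s.count y = 1 := by
      intro y hy
      induction y, hy using Nat.le_induction with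
      | base => exact fun _ => hsj
      | succ y hy ih =>
        intro hyi
        have h2 := hno y hy (by omega) (ih (by omega))
        have := hone (y + 1)
        omega
    have := this i hjp.le le_rfl
    omega
  have hx5 : piFixed p n x = p := by
    by_cases hpx : p ≤ x
    · have h2 := hbal x (by omega) hpx
      rw [hx3, hx4] at h2
      have h3 := hone (x - p)
      have h4 := piFixed_le hp n x
      omega
    · have h2 := hs.balance x
      simp only [addGrain, Finsupp.add_apply, Finsupp.single_apply] at h2
      rw [if_neg (by omega), if_neg hpx, hx3, hx4] at h2
      have h3 := piFixed_le hp n x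
      omega
  refine hl x (by omega) hx5 (i - x) (by omega) ?_
  rw [Nat.add_sub_cancel' hx2.le]
  exact hbi

theorem denseFrom_of_succ_mem {s : List ℕ} {l : ℕ} (hl0 : 0 < l)
    (h : ∀ i, l ≤ i → i + 1 ∈ s → i ∈ s) : DenseFrom s l := by
  by_cases hne : ∃ i ∈ s, l ≤ i
  · obtain ⟨i, hi, hli⟩ := hne
    obtain ⟨m, hm, hmax⟩ := s.toFinset.exists_max_image id ⟨i, by simpa using hi⟩
    simp only [List.mem_toFinset, id_eq] at hm hmax
    refine ⟨m, fun j hj hjm => ?_, fun j hj hjs => absurd (hmax j hjs) (by omega)⟩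
    induction hjm using Nat.decreasingInduction with
    | self => exact hm
    | of_succ k _ ih => exact h k hj (ih (by omega))
  · push Not at hne
    -- Nothing fires from `l` on: the block is empty, and `hl0` keeps `l - 1` below `l`.
    exact ⟨l - 1, fun i h1 h2 => by omega, fun i hi his => by have := hne i his; omega⟩

/-! ### Logarithmic bound -/

theorem localDensityColumn_le (hp : 0 < p) {n t : ℕ}
    (ht : 2 * (n : ℝ) ^ 2 * (1 - 1 / (p : ℝ) ^ p) ^ t < 1) :
    localDensityColumn p n ≤ p * t + 2 * p := by
  obtain ⟨d, hd, hA⟩ := exists_averaging_piFixed hp n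
  obtain ⟨i, hi, hc⟩ := hd.exists_constWindow hp hA ht
  have hdense : DenseFrom (avalanche p n) (i + p + p) := by
    apply denseFrom_of_succ_mem (by omega)
    intro j hj
    apply mem_avalanche_of_succ_mem hp (l := i + p) (fun x hx hb k hk => ?_) hj
    have := hd.wave hp hc hx (by exact_mod_cast hb) hk
    beta_reduce at this
    omega
  have := Nat.sInf_le (s := {l : ℕ | DenseFrom (avalanche p n) l}) hdense
  unfold localDensityColumn
  omega

theorem globalDensityColumn_le (hp : 0 < p) {N : ℕ} (hN : 2 ≤ N) :
    (globalDensityColumn p N : ℝ) ≤ (4 * (p : ℝ) ^ (p + 1) + 6 * p) * Real.log N := by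
  have hN' : (2 : ℝ) ≤ N := by exact_mod_cast hN
  have hp1 : (1 : ℝ) ≤ p := by exact_mod_cast hp
  have hP : (0 : ℝ) < (p : ℝ) ^ p := by positivity
  -- Used at the end to absorb the additive constant `3 * p`.
  have hlog : 1 / 2 ≤ Real.log N := by
    have h1 := Real.log_two_gt_d9
    have h2 := Real.log_le_log (by norm_num) hN'
    linarith
  -- Chosen so that `t` contractions give a factor below `N ^ (-4)`, which beats the initial spread
  -- `2 * N ^ 2` once `N ≥ 2`.
  set t := ⌊(p : ℝ) ^ p * (4 * Real.log N)⌋₊ + 1 with ht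
  have ht1 : (p : ℝ) ^ p * (4 * Real.log N) < t := by
    rw [ht]
    exact_mod_cast Nat.lt_floor_add_one _
  have ht2 : (t : ℝ) ≤ (p : ℝ) ^ p * (4 * Real.log N) + 1 := by
    rw [ht, Nat.cast_add, Nat.cast_one]
    gcongr
    exact Nat.floor_le (by positivity)
  have hq : 0 ≤ 1 - 1 / (p : ℝ) ^ p := by
    have : 1 / (p : ℝ) ^ p ≤ 1 := by
      rw [div_le_one hP]
      exact one_le_pow₀ hp1
    linarith
  have hpow : (1 - 1 / (p : ℝ) ^ p) ^ t < ((N : ℝ) ^ 4)⁻¹ := by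
    calc (1 - 1 / (p : ℝ) ^ p) ^ t ≤ Real.exp (-(1 / (p : ℝ) ^ p)) ^ t :=
          pow_le_pow_left₀ hq (Real.one_sub_le_exp_neg _) t
      _ = Real.exp (-(t / (p : ℝ) ^ p)) := by rw [← Real.exp_nat_mul]; congr 1; ring
      _ < Real.exp (-(4 * Real.log N)) := by
          apply Real.exp_lt_exp.2
          apply neg_lt_neg
          rw [lt_div_iff₀ hP]
          linarith
      _ = ((N : ℝ) ^ 4)⁻¹ := by
          rw [Real.exp_neg, ← Real.exp_log (show (0 : ℝ) < N by linarith), ← Real.exp_nat_mul,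
            Real.log_exp]
          norm_num
  have hnat : globalDensityColumn p N ≤ p * t + 2 * p := by
    apply Finset.sup_le
    intro n hn
    apply localDensityColumn_le hp
    have hnN : (n : ℝ) ≤ N := by exact_mod_cast (mem_range.1 hn).le
    have h4 : (0 : ℝ) < (N : ℝ) ^ 4 := by positivity
    calc 2 * (n : ℝ) ^ 2 * (1 - 1 / (p : ℝ) ^ p) ^ t
        ≤ 2 * (N : ℝ) ^ 2 * (1 - 1 / (p : ℝ) ^ p) ^ t := by gcongr
      _ < 2 * (N : ℝ) ^ 2 * ((N : ℝ) ^ 4)⁻¹ := by gcongr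
      _ ≤ 1 := by
          rw [← div_eq_mul_inv, div_le_one h4]
          nlinarith [mul_nonneg (sq_nonneg (N : ℝ)) (show (0 : ℝ) ≤ (N : ℝ) ^ 2 - 2 by nlinarith)]
  calc (globalDensityColumn p N : ℝ) ≤ p * t + 2 * p := by exact_mod_cast hnat
    _ ≤ p * ((p : ℝ) ^ p * (4 * Real.log N) + 1) + 2 * p := by gcongr
    _ = 4 * (p : ℝ) ^ (p + 1) * Real.log N + 6 * p * (1 / 2) := by ring
    _ ≤ 4 * (p : ℝ) ^ (p + 1) * Real.log N + 6 * p * Real.log N := by gcongr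
    _ = _ := by ring

end KSPM

theorem mainTheorem3 (p : ℕ) (hp : 0 < p) :
    (fun N : ℕ => (KSPM.globalDensityColumn p N : ℝ)) =O[Filter.atTop]
      (fun N : ℕ => Real.log (N : ℝ)) := by
  refine Asymptotics.IsBigO.of_bound (4 * (p : ℝ) ^ (p + 1) + 6 * p) ?_
  filter_upwards [Filter.eventually_ge_atTop 2] with N hN
  have hlog : 0 ≤ Real.log (N : ℝ) := Real.log_natCast_nonneg N
  rw [Real.norm_of_nonneg (Nat.cast_nonneg _), Real.norm_of_nonneg hlog]
  exact KSPM.globalDensityColumn_le hp hN
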